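/- Let $(\mathcal{C},\mathbb{E},\mathfrak{s})$ be a small extriangulated category (in the sense of Nakaoka–Palu), and let $\{\mathbb{E}^i\}_{i\ge 1}$ be higher extension groups of $\mathcal{C}$: additive bifunctors $\mathbb{E}^i:\mathcal{C}^{op}\times\mathcal{C}\to \mathrm{Ab}$ with $\mathbb{E}^1=\mathbb{E}$, such that every $\mathbb{E}$-triangle $A\to B\to C\overset{\delta}{\dashrightarrow}$ gives long exact sequences $$\mathbb{E}^i(C,-)\to\mathbb{E}^i(B,-)\to\mathbb{E}^i(A,-)\to\mathbb{E}^{i+1}(C,-)\to\mathbb{E}^{i+1}(B,-)\to\cdots,$$ $$\mathbb{E}^i(-,A)\to\mathbb{E}^i(-,B)\to\mathbb{E}^i(-,C)\to\mathbb{E}^{i+1}(-,A)\to\mathbb{E}^{i+1}(-,B)\to\cdots\qquad(i\ge 1)$$ whose connecting transformations are natural in the $\mathbb{E}$-triangle, and such that, for all $i\geq 1$, $\mathbb{E}^i(f,-)=0$ whenever $\mathbb{E}(f,-)=0$ and $\mathbb{E}^i(-,g)=0$ whenever $\mathbb{E}(-,g)=0$. (Every small extriangulated category has such a family.) Let $n\ge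 1$ and let $\mathcal{X}\subseteq\mathcal{C}$ be an $(n+2)$-cluster tilting subcategory, that is, a full subcategory such that * every $M\in\mathcal{C}$ admits conflations $K\to X\overset{g}{\to} M$ and $M\overset{f}{\to} X'\to L$ with $X,X'\in\mathcal{X}$, $g$ an $\mathcal{X}$-precover and $f$ an $\mathcal{X}$-preenvelope, and * $\mathcal{X}=\{N : \mathbb{E}^k(\mathcal{X},N)=0 \text{ for } 1\le k\le n+1\}=\{M : \mathbb{E}^k(M,\mathcal{X})=0\text{ for } 1\le k\le n+1\}$. Let $\mathcal{X}_n^{\vee}$ (respectively $\mathcal{X}_n^{\wedge}$) be the class of objects that have a finite $\mathcal{X}$-coresolution $0\to M\to X_0\to\cdots\to X_m\to 0$ (respectively a finite $\mathcal{X}$-resolution $0\to X_m\to\cdots\to X_0\to M\to 0$), built from conflations, of some length $m\le n$, and let $\mathcal{P}_{\mathbb{E}}(\mathcal{C})$ and $\mathcal{I}_{\mathbb{E}}(\mathcal{C})$ be the classes of $\mathbb{E}$-projective and $\mathbb{E}$-injective objects. Then the following statements are equivalent. (a) $\mathbb{E}(\mathcal{X}_n^{\vee},\mathcal{X}_n^{\vee})=0$.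 (b) $\mathcal{C}=\mathcal{X}$. (c) $\mathcal{X}=\mathcal{P}_{\mathbb{E}}(\mathcal{C})=\mathcal{I}_{\mathbb{E}}(\mathcal{C})$. (d) $\mathbb{E}(\mathcal{X}_n^{\wedge},\mathcal{X}_n^{\wedge})=0$. -/

import Mathlib

open CategoryTheory CategoryTheory.Limits Opposite

universe w v u

namespace ExtriCat

/-! ### Additive bifunctors with values in abelian groups -/

section Bifunctors

variable {C : Type u} [Category.{v} C]

/-- `Val H Z A` is the abelian group `H(Z, A)` of a bifunctor `H : Cᵒᵖ × C → Ab`. -/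
abbrev Val (H : Cᵒᵖ ⥤ C ⥤ AddCommGrpCat.{w}) (Z A : C) : Type w := (H.obj (op Z)).obj A

/-- The homomorphism `H(Z, a) : H(Z, A) → H(Z, A')`, written `a · δ` on elements. -/
def push (H : Cᵒᵖ ⥤ C ⥤ AddCommGrpCat.{w}) {Z A A' : C} (a : A ⟶ A') :
    Val H Z A →+ Val H Z A' :=
  ((H.obj (op Z)).map a).hom

/-- The homomorphism `H(c, A) : H(Z, A) → H(Z', A)`, written `δ · c` on elements. -/
def pull (H : Cᵒᵖ ⥤ C ⥤ AddCommGrpCat.{w}) {Z' Z A : C} (c : Z' ⟶ Z) :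
    Val H Z A →+ Val H Z' A :=
  ((H.map c.op).app A).hom

/-- An additive bifunctor: additive in each of the two variables. -/
def IsAdditiveBifunctor [Preadditive C] (H : Cᵒᵖ ⥤ C ⥤ AddCommGrpCat.{w}) : Prop :=
  (∀ {Z A A' : C} (a b : A ⟶ A') (δ : Val H Z A), push H (a + b) δ = push H a δ + push H b δ) ∧
  (∀ {Z' Z A : C} (c d : Z' ⟶ Z) (δ : Val H Z A), pull H (c + d) δ = pull H c δ + pull H d δ)

end Bifunctors

/-! ### Equivalence classes of sequences `A ⟶ B ⟶ Z` -/

section Sequences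

variable {C : Type u} [Category.{v} C]

/-- A sequence of morphisms `A ⟶ B ⟶ Z` with fixed ends. -/
structure Seq (A Z : C) where
  mid : C
  inl : A ⟶ mid
  pr : mid ⟶ Z

/-- Two sequences are equivalent if there is an isomorphism of the middle terms that is
compatible with the identities of the ends. -/
instance seqSetoid (A Z : C) : Setoid (Seq A Z) where
  r S S' := ∃ b : S.mid ≅ S'.mid, S.inl ≫ b.hom = S'.inl ∧ b.hom ≫ S'.pr = S.pr
  iseqv :=
    { refl := fun S => ⟨Iso.refl _, by simp, by simp⟩
      symm := by
        rintro S S' ⟨b, h1, h2⟩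
        exact ⟨b.symm, by simp [← h1], by simp [← h2]⟩
      trans := by
        rintro S S' S'' ⟨b, h1, h2⟩ ⟨b', h1', h2'⟩
        exact ⟨b ≪≫ b', by simp [← h1', ← h1], by simp [h2', h2]⟩ }

/-- The type of equivalence classes `[A ⟶ B ⟶ Z]`. -/
abbrev SeqClass (A Z : C) := Quotient (seqSetoid A Z)

/-- The equivalence class `[A ⟶ B ⟶ Z]`. -/
def seqClass {A B Z : C} (x : A ⟶ B) (y : B ⟶ Z) : SeqClass A Z := Quotient.mk _ ⟨B, x, y⟩

end Sequences

/-! ### Extriangulated categories -/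

section Sum

variable {C : Type u} [Category.{v} C] [Preadditive C] [HasZeroObject C] [HasBinaryBiproducts C]

/-- The element `δ ⊕ δ'` of `H(Z ⊞ Z', A ⊞ A')` with components `(δ, 0, 0, δ')`. -/
noncomputable def extSum (H : Cᵒᵖ ⥤ C ⥤ AddCommGrpCat.{w}) {Z A Z' A' : C}
    (δ : Val H Z A) (δ' : Val H Z' A') : Val H (Z ⊞ Z') (A ⊞ A') :=
  push H biprod.inl (pull H biprod.fst δ) + push H biprod.inr (pull H biprod.snd δ')

end Sum

/-- An external triangulation `(𝔼, 𝔰)` of an additive category `C`; together with it, `C` is an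
extriangulated category. -/
structure ExternalTriangulation (C : Type u) [Category.{v} C] [Preadditive C]
    [HasZeroObject C] [HasBinaryBiproducts C] where
  /-- the bifunctor `𝔼 : Cᵒᵖ × C → Ab` -/
  E : Cᵒᵖ ⥤ C ⥤ AddCommGrpCat.{w}
  /-- (ET1) -/
  additive : IsAdditiveBifunctor E
  /-- the correspondence `𝔰` -/
  s : ∀ {A Z : C}, Val E Z A → SeqClass A Z
  /-- (ET2): `𝔰` is a realization of `𝔼` -/
  realization : ∀ {A B Z A' B' Z' : C} {x : A ⟶ B} {y : B ⟶ Z} {x' : A' ⟶ B'} {y' : B' ⟶ Z'}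
    (δ : Val E Z A) (δ' : Val E Z' A'), s δ = seqClass x y → s δ' = seqClass x' y' →
    ∀ (a : A ⟶ A') (c : Z ⟶ Z'), push E a δ = pull E c δ' →
      ∃ b : B ⟶ B', x ≫ b = a ≫ x' ∧ y ≫ c = b ≫ y'
  /-- (ET2): the split extension is realized by the split sequence -/
  s_zero : ∀ A Z : C,
    s (0 : Val E Z A) = seqClass (biprod.inl : A ⟶ A ⊞ Z) (biprod.snd : A ⊞ Z ⟶ Z)
  /-- (ET2): `𝔰(δ ⊕ δ') = 𝔰(δ) ⊕ 𝔰(δ')` -/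
  s_sum : ∀ {A B Z A' B' Z' : C} {x : A ⟶ B} {y : B ⟶ Z} {x' : A' ⟶ B'} {y' : B' ⟶ Z'}
    (δ : Val E Z A) (δ' : Val E Z' A'), s δ = seqClass x y → s δ' = seqClass x' y' →
      s (extSum E δ δ') = seqClass (biprod.map x x') (biprod.map y y')
  /-- (ET3) -/
  et3 : ∀ {A B Z A' B' Z' : C} {x : A ⟶ B} {y : B ⟶ Z} {x' : A' ⟶ B'} {y' : B' ⟶ Z'}
    (δ : Val E Z A) (δ' : Val E Z' A'), s δ = seqClass x y → s δ' = seqClass x' y' →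
    ∀ (a : A ⟶ A') (b : B ⟶ B'), x ≫ b = a ≫ x' →
      ∃ c : Z ⟶ Z', push E a δ = pull E c δ' ∧ y ≫ c = b ≫ y'
  /-- (ET3)ᵒᵖ -/
  et3_op : ∀ {A B Z A' B' Z' : C} {x : A ⟶ B} {y : B ⟶ Z} {x' : A' ⟶ B'} {y' : B' ⟶ Z'}
    (δ : Val E Z A) (δ' : Val E Z' A'), s δ = seqClass x y → s δ' = seqClass x' y' →
    ∀ (b : B ⟶ B') (c : Z ⟶ Z'), y ≫ c = b ≫ y' →
      ∃ a : A ⟶ A', push E a δ = pull E c δ' ∧ x ≫ b = a ≫ x'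
  /-- (ET4) -/
  et4 : ∀ {A B D M F : C} {f : A ⟶ B} {f' : B ⟶ D} {g : B ⟶ M} {g' : M ⟶ F}
    (δ : Val E D A) (δ' : Val E F B), s δ = seqClass f f' → s δ' = seqClass g g' →
    ∃ (N : C) (h' : M ⟶ N) (d : D ⟶ N) (e : N ⟶ F) (δ'' : Val E N A),
      f' ≫ d = g ≫ h' ∧ h' ≫ e = g' ∧ s δ'' = seqClass (f ≫ g) h' ∧
      s (push E f' δ') = seqClass d e ∧ pull E d δ'' = δ ∧ push E f δ'' = pull E e δ'
  /-- (ET4)ᵒᵖ -/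
  et4_op : ∀ {D A B F Z : C} {f' : D ⟶ A} {f : A ⟶ B} {g' : F ⟶ B} {g : B ⟶ Z}
    (δ : Val E B D) (δ' : Val E Z F), s δ = seqClass f' f → s δ' = seqClass g' g →
    ∃ (N : C) (d : D ⟶ N) (e : N ⟶ F) (h' : N ⟶ A) (δ'' : Val E Z N),
      d ≫ h' = f' ∧ h' ≫ f = e ≫ g' ∧ s δ'' = seqClass h' (f ≫ g) ∧
      s (pull E g' δ) = seqClass d e ∧ δ' = push E e δ'' ∧ push E d δ = pull E g δ''

namespace ExternalTriangulation

variable {C : Type u} [Category.{v} C] [Preadditive C] [HasZeroObject C] [HasBinaryBiproducts C]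
variable (T : ExternalTriangulation.{w} C)

/-- `A ⟶ B ⟶ Z` together with `δ ∈ 𝔼(Z, A)` is an `𝔼`-triangle. -/
def IsTriangle {A B Z : C} (x : A ⟶ B) (y : B ⟶ Z) (δ : Val T.E Z A) : Prop :=
  T.s δ = seqClass x y

/-- `A ⟶ B ⟶ Z` is a conflation. -/
def IsConflation {A B Z : C} (x : A ⟶ B) (y : B ⟶ Z) : Prop :=
  ∃ δ : Val T.E Z A, T.IsTriangle x y δ

/-- The class `𝒫_𝔼(C)` of `𝔼`-projective objects. -/
def projectives : ObjectProperty C := fun P =>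
  ∀ ⦃A B Z : C⦄ (x : A ⟶ B) (y : B ⟶ Z), T.IsConflation x y →
    ∀ f : P ⟶ Z, ∃ g : P ⟶ B, g ≫ y = f

/-- The class `ℐ_𝔼(C)` of `𝔼`-injective objects. -/
def injectives : ObjectProperty C := fun I =>
  ∀ ⦃A B Z : C⦄ (x : A ⟶ B) (y : B ⟶ Z), T.IsConflation x y →
    ∀ f : A ⟶ I, ∃ g : B ⟶ I, x ≫ g = f

/-- `𝔼`-projective morphisms: `𝔼(f, -) = 0`. -/
def IsProjectiveMorphism {M N : C} (f : M ⟶ N) : Prop :=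
  ∀ (A : C) (δ : Val T.E N A), pull T.E f δ = 0

/-- `𝔼`-injective morphisms: `𝔼(-, g) = 0`. -/
def IsInjectiveMorphism {M N : C} (g : M ⟶ N) : Prop :=
  ∀ (Z : C) (δ : Val T.E Z M), push T.E g δ = 0

/-- `M` has a finite `X`-resolution `0 → X_n → ⋯ → X_0 → M → 0` of length `n`, built from
conflations. -/
def HasResolution (X : ObjectProperty C) : ℕ → C → Prop
  | 0, M => X.isoClosure M
  | n + 1, M => ∃ (K X₀ : C) (x : K ⟶ X₀) (y : X₀ ⟶ M),
      T.IsConflation x y ∧ X X₀ ∧ HasResolution X n K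

/-- `M` has a finite `X`-coresolution `0 → M → X_0 → ⋯ → X_n → 0` of length `n`, built from
conflations. -/
def HasCoresolution (X : ObjectProperty C) : ℕ → C → Prop
  | 0, M => X.isoClosure M
  | n + 1, M => ∃ (X₀ L : C) (x : M ⟶ X₀) (y : X₀ ⟶ L),
      T.IsConflation x y ∧ X X₀ ∧ HasCoresolution X n L

/-- The class `X_n^∧` of the objects of `X`-resolution dimension at most `n`. -/
def resClass (X : ObjectProperty C) (n : ℕ) : ObjectProperty C := fun M =>
  ∃ m ≤ n, T.HasResolution X m M

/-- The class `X_n^∨` of the objects of `X`-coresolution dimension at most `n`. -/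
def coresClass (X : ObjectProperty C) (n : ℕ) : ObjectProperty C := fun M =>
  ∃ m ≤ n, T.HasCoresolution X m M

/-- `X` is strongly precovering: every object is the end term of an `𝔼`-triangle
`K ⟶ X₀ ⟶ M` in which `X₀ ⟶ M` is an `X`-precover. -/
def IsStronglyPrecovering (X : ObjectProperty C) : Prop :=
  ∀ M : C, ∃ (K X₀ : C) (x : K ⟶ X₀) (g : X₀ ⟶ M), T.IsConflation x g ∧ X X₀ ∧
    ∀ (X' : C), X X' → ∀ f : X' ⟶ M, ∃ f' : X' ⟶ X₀, f' ≫ g = f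

/-- `X` is strongly preenveloping: every object is the first term of an `𝔼`-triangle
`M ⟶ X₀ ⟶ L` in which `M ⟶ X₀` is an `X`-preenvelope. -/
def IsStronglyPreenveloping (X : ObjectProperty C) : Prop :=
  ∀ M : C, ∃ (X₀ L : C) (g : M ⟶ X₀) (y : X₀ ⟶ L), T.IsConflation g y ∧ X X₀ ∧
    ∀ (X' : C), X X' → ∀ f : M ⟶ X', ∃ f' : X₀ ⟶ X', g ≫ f' = f

end ExternalTriangulation

/-- `H(𝒳, 𝒴) = 0` for classes of objects `𝒳` and `𝒴`. -/
def VanishesOn {C : Type u} [Category.{v} C] (H : Cᵒᵖ ⥤ C ⥤ AddCommGrpCat.{w})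
    (X Y : ObjectProperty C) : Prop :=
  ∀ M N : C, X M → Y N → ∀ δ : Val H M N, δ = 0

/-- Higher `𝔼`-extension groups of an extriangulated category: a family `{𝔼ⁱ}_{i ≥ 1}` of additive
bifunctors with `𝔼¹ = 𝔼`, with long exact sequences in both variables that are natural in the
`𝔼`-triangle, and vanishing on `𝔼`-projective and `𝔼`-injective morphisms.
Only the values `ext i` with `1 ≤ i` carry meaning. -/
structure HigherExtensionGroups {C : Type u} [Category.{v} C] [Preadditive C]
    [HasZeroObject C] [HasBinaryBiproducts C] (T : ExternalTriangulation.{w} C) where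
  /-- the bifunctor `𝔼ⁱ`, for `i ≥ 1` -/
  ext : ℕ → (Cᵒᵖ ⥤ C ⥤ AddCommGrpCat.{w})
  additive : ∀ i, 1 ≤ i → IsAdditiveBifunctor (ext i)
  ext_one : ext 1 = T.E
  /-- the connecting transformation `𝔼ⁱ(A, -) ⟶ 𝔼ⁱ⁺¹(Z, -)` of `δ ∈ 𝔼(Z, A)` -/
  conn₁ : ∀ (i : ℕ) {A Z : C}, Val T.E Z A → ((ext i).obj (op A) ⟶ (ext (i + 1)).obj (op Z))
  /-- the connecting transformation `𝔼ⁱ(-, Z) ⟶ 𝔼ⁱ⁺¹(-, A)` of `δ ∈ 𝔼(Z, A)` -/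
  conn₂ : ∀ (i : ℕ) {A Z : C}, Val T.E Z A → ((ext i).flip.obj Z ⟶ (ext (i + 1)).flip.obj A)
  exact₁_mid : ∀ i, 1 ≤ i → ∀ {A B Z : C} (x : A ⟶ B) (y : B ⟶ Z) (δ : Val T.E Z A),
    T.IsTriangle x y δ → ∀ Y : C,
      Function.Exact (pull (ext i) (A := Y) y) (pull (ext i) (A := Y) x)
  exact₁_left : ∀ i, 1 ≤ i → ∀ {A B Z : C} (x : A ⟶ B) (y : B ⟶ Z) (δ : Val T.E Z A),
    T.IsTriangle x y δ → ∀ Y : C,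
      Function.Exact (pull (ext i) (A := Y) x) ((conn₁ i δ).app Y).hom
  exact₁_right : ∀ i, 1 ≤ i → ∀ {A B Z : C} (x : A ⟶ B) (y : B ⟶ Z) (δ : Val T.E Z A),
    T.IsTriangle x y δ → ∀ Y : C,
      Function.Exact ((conn₁ i δ).app Y).hom (pull (ext (i + 1)) (A := Y) y)
  exact₂_mid : ∀ i, 1 ≤ i → ∀ {A B Z : C} (x : A ⟶ B) (y : B ⟶ Z) (δ : Val T.E Z A),
    T.IsTriangle x y δ → ∀ Y : C,
      Function.Exact (push (ext i) (Z := Y) x) (push (ext i) (Z := Y) y)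
  exact₂_right : ∀ i, 1 ≤ i → ∀ {A B Z : C} (x : A ⟶ B) (y : B ⟶ Z) (δ : Val T.E Z A),
    T.IsTriangle x y δ → ∀ Y : C,
      Function.Exact (push (ext i) (Z := Y) y) ((conn₂ i δ).app (op Y)).hom
  exact₂_left : ∀ i, 1 ≤ i → ∀ {A B Z : C} (x : A ⟶ B) (y : B ⟶ Z) (δ : Val T.E Z A),
    T.IsTriangle x y δ → ∀ Y : C,
      Function.Exact ((conn₂ i δ).app (op Y)).hom (push (ext (i + 1)) (Z := Y) x)
  /-- naturality for a morphism `(a, c) : δ ⟶ δ'` of extensions; by (ET2), these are exactly the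
  outer components of the morphisms `(a, b, c)` of `𝔼`-triangles -/
  conn₁_natural : ∀ i, 1 ≤ i → ∀ {A Z A' Z' : C} (δ : Val T.E Z A) (δ' : Val T.E Z' A')
    (a : A ⟶ A') (c : Z ⟶ Z'), push T.E a δ = pull T.E c δ' →
      (ext i).map a.op ≫ conn₁ i δ = conn₁ i δ' ≫ (ext (i + 1)).map c.op
  conn₂_natural : ∀ i, 1 ≤ i → ∀ {A Z A' Z' : C} (δ : Val T.E Z A) (δ' : Val T.E Z' A')
    (a : A ⟶ A') (c : Z ⟶ Z'), push T.E a δ = pull T.E c δ' →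
      (ext i).flip.map c ≫ conn₂ i δ' = conn₂ i δ ≫ (ext (i + 1)).flip.map a
  projective_vanish : ∀ i, 1 ≤ i → ∀ {M N : C} (f : M ⟶ N), T.IsProjectiveMorphism f →
    ∀ (A : C) (t : Val (ext i) N A), pull (ext i) f t = 0
  injective_vanish : ∀ i, 1 ≤ i → ∀ {M N : C} (g : M ⟶ N), T.IsInjectiveMorphism g →
    ∀ (Z : C) (t : Val (ext i) Z M), push (ext i) g t = 0

namespace HigherExtensionGroups

variable {C : Type u} [Category.{v} C] [Preadditive C] [HasZeroObject C] [HasBinaryBiproducts C]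
variable {T : ExternalTriangulation.{w} C}

/-- `X` is an `(n+2)`-cluster tilting subcategory:
(CT1) `X` is strongly precovering and strongly preenveloping;
(CT2) `X = ⋂_{k=1}^{n+1} X^{⊥ₖ} = ⋂_{k=1}^{n+1} {}^{⊥ₖ}X`. -/
structure IsClusterTilting (H : HigherExtensionGroups T) (n : ℕ) (X : ObjectProperty C) :
    Prop where
  precovering : T.IsStronglyPrecovering X
  preenveloping : T.IsStronglyPreenveloping X
  eq_right : ∀ N : C, X N ↔ ∀ k, 1 ≤ k → k ≤ n + 1 →
    ∀ M : C, X M → ∀ δ : Val (H.ext k) M N, δ = 0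
  eq_left : ∀ M : C, X M ↔ ∀ k, 1 ≤ k → k ≤ n + 1 →
    ∀ N : C, X N → ∀ δ : Val (H.ext k) M N, δ = 0

end HigherExtensionGroups

/-! ### Small extriangulated categories have higher extension groups

What follows is not needed to read the definitions above. It constructs, for a small
extriangulated category, a family of higher extension groups, so that this notion is never empty. -/

section
variable {C : Type u} [Category.{v} C] (H : Cᵒᵖ ⥤ C ⥤ AddCommGrpCat.{w})

theorem push_id {Z A : C} (t : Val H Z A) : push H (𝟙 A) t = t := by simp [push]
theorem push_comp {Z A B D : C} (a : A ⟶ B) (b : B ⟶ D) (t : Val H Z A) :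
    push H (a ≫ b) t = push H b (push H a t) := by simp [push]
theorem pull_id {Z A : C} (t : Val H Z A) : pull H (𝟙 Z) t = t := by simp [pull]
theorem pull_comp {W Y Z A : C} (c : W ⟶ Y) (d : Y ⟶ Z) (t : Val H Z A) :
    pull H (c ≫ d) t = pull H c (pull H d t) := by simp [pull]
theorem push_pull {Y Z A B : C} (a : A ⟶ B) (c : Y ⟶ Z) (t : Val H Z A) :
    push H a (pull H c t) = pull H c (push H a t) := by
  have := congrArg (fun f => f.hom t) ((H.map c.op).naturality a)
  exact this.symm
end

section
variable {C : Type u} [Category.{v} C] [Preadditive C] {H : Cᵒᵖ ⥤ C ⥤ AddCommGrpCat.{w}}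

theorem push_zero (hH : IsAdditiveBifunctor H) {Z A B : C} (t : Val H Z A) : push H (0 : A ⟶ B) t = 0 := by
  have := hH.1 (0 : A ⟶ B) 0 t
  simpa using this
theorem pull_zero (hH : IsAdditiveBifunctor H) {Y Z A : C} (t : Val H Z A) : pull H (0 : Y ⟶ Z) t = 0 := by
  have := hH.2 (0 : Y ⟶ Z) 0 t
  simpa using this
theorem push_neg (hH : IsAdditiveBifunctor H) {Z A B : C} (a : A ⟶ B) (t : Val H Z A) : push H (-a) t = - push H a t := by
  have := hH.1 a (-a) t
  rw [add_neg_cancel, push_zero hH] at this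
  exact (neg_eq_of_add_eq_zero_right this.symm).symm
theorem pull_neg (hH : IsAdditiveBifunctor H) {Y Z A : C} (a : Y ⟶ Z) (t : Val H Z A) : pull H (-a) t = - pull H a t := by
  have := hH.2 a (-a) t
  rw [add_neg_cancel, pull_zero hH] at this
  exact (neg_eq_of_add_eq_zero_right this.symm).symm
theorem push_sub (hH : IsAdditiveBifunctor H) {Z A B : C} (a b : A ⟶ B) (t : Val H Z A) :
    push H (a - b) t = push H a t - push H b t := by
  rw [sub_eq_add_neg, hH.1, push_neg hH, sub_eq_add_neg]
theorem pull_sub (hH : IsAdditiveBifunctor H) {Y Z A : C} (a b : Y ⟶ Z) (t : Val H Z A) :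
    pull H (a - b) t = pull H a t - pull H b t := by
  rw [sub_eq_add_neg, hH.2, pull_neg hH, sub_eq_add_neg]
theorem pull_pull_zero (hH : IsAdditiveBifunctor H)
    {A B Z Y : C} {x : A ⟶ B} {y : B ⟶ Z} (h : x ≫ y = 0) (t : Val H Z Y) :
    pull H x (pull H y t) = 0 := by
  rw [← pull_comp, h, pull_zero hH]

theorem push_push_zero (hH : IsAdditiveBifunctor H)
    {A B Z Y : C} {x : A ⟶ B} {y : B ⟶ Z} (h : x ≫ y = 0) (t : Val H Y A) :
    push H y (push H x t) = 0 := by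
  rw [← push_comp, h, push_zero hH]
end

theorem seqClass_eq_iff {C : Type u} [Category.{v} C] {A B B' Z : C} (x : A ⟶ B) (y : B ⟶ Z)
    (x' : A ⟶ B') (y' : B' ⟶ Z) : seqClass x y = seqClass x' y' ↔
      ∃ b : B ≅ B', x ≫ b.hom = x' ∧ b.hom ≫ y' = y :=
  Quotient.eq

namespace ExternalTriangulation
open ZeroObject
variable {C : Type u} [Category.{v} C] [Preadditive C] [HasZeroObject C] [HasBinaryBiproducts C]
variable (T : ExternalTriangulation.{w} C)

theorem exists_triangle {A Z : C} (δ : Val T.E Z A) :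
    ∃ (B : C) (x : A ⟶ B) (y : B ⟶ Z), T.IsTriangle x y δ := by
  obtain ⟨S, hS⟩ := Quotient.exists_rep (T.s δ)
  exact ⟨S.mid, S.inl, S.pr, hS.symm⟩

theorem triangle_zero_left (B : C) : T.IsTriangle (0 : 0 ⟶ B) (𝟙 B) 0 := by
  refine (T.s_zero 0 B).trans ?_
  rw [seqClass_eq_iff]
  refine ⟨⟨biprod.snd, biprod.inr, ?_, by simp⟩, by simp, by simp⟩
  ext
  simp

theorem triangle_zero_right (B : C) : T.IsTriangle (𝟙 B) (0 : B ⟶ 0) 0 := by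
  refine (T.s_zero B 0).trans ?_
  rw [seqClass_eq_iff]
  refine ⟨⟨biprod.fst, biprod.inl, ?_, by simp⟩, by simp, (isZero_zero C).eq_of_tgt _ _⟩
  ext
  simp

theorem triangle_desc {M N : C} (m : M ⟶ N) :
    T.IsTriangle (biprod.lift (𝟙 M) (-m)) (biprod.desc m (𝟙 N)) 0 := by
  refine (T.s_zero M N).trans ?_
  rw [seqClass_eq_iff]
  refine ⟨⟨biprod.lift biprod.fst (biprod.snd - biprod.fst ≫ m),
    biprod.lift biprod.fst (biprod.snd + biprod.fst ≫ m), ?_, ?_⟩, ?_, ?_⟩ <;>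
  ext <;> simp

variable {T} {A B Z : C} {x : A ⟶ B} {y : B ⟶ Z} {δ : Val T.E Z A}

theorem IsTriangle.pull_eq_zero (h : T.IsTriangle x y δ) : pull T.E y δ = 0 := by
  obtain ⟨c, h1, h2⟩ := T.et3 0 δ (T.triangle_zero_left B) h 0 (𝟙 B) (by simp)
  rw [Category.id_comp, Category.id_comp] at h2
  subst h2
  simpa using h1.symm

theorem IsTriangle.push_eq_zero (h : T.IsTriangle x y δ) : push T.E x δ = 0 := by
  obtain ⟨c, h1, h2⟩ := T.et3_op δ 0 h (T.triangle_zero_right B) (𝟙 B) 0 (by simp)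
  rw [Category.comp_id, Category.comp_id] at h2
  subst h2
  simpa using h1

theorem IsTriangle.comp_eq_zero (h : T.IsTriangle x y δ) : x ≫ y = 0 := by
  obtain ⟨c, h1, h2⟩ := T.et3 0 δ (T.triangle_zero_right A) h (𝟙 A) x (by simp)
  rw [← h2, (isZero_zero C).eq_of_src c 0, comp_zero]

theorem IsTriangle.lift (h : T.IsTriangle x y δ) {W : C} (f : W ⟶ Z) (hf : pull T.E f δ = 0) : ∃ g : W ⟶ B, g ≫ y = f := by
  obtain ⟨b, h1, h2⟩ := T.realization 0 δ (T.triangle_zero_left W) h 0 f (by simp [hf])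
  exact ⟨b, by simpa using h2.symm⟩

theorem IsTriangle.desc (h : T.IsTriangle x y δ) {W : C} (f : A ⟶ W) (hf : push T.E f δ = 0) : ∃ g : B ⟶ W, x ≫ g = f := by
  obtain ⟨b, h1, h2⟩ := T.realization δ 0 h (T.triangle_zero_right W) f 0 (by simp [hf])
  exact ⟨b, by simpa using h1⟩

theorem IsTriangle.exact_push (h : T.IsTriangle x y δ) {W : C} (ρ : Val T.E W A) (hρ : push T.E x ρ = 0) :
    ∃ f : W ⟶ Z, ρ = pull T.E f δ := by
  obtain ⟨M, p, q, hM⟩ := T.exists_triangle ρ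
  obtain ⟨g, hg⟩ := hM.desc x hρ
  obtain ⟨c, h1, h2⟩ := T.et3 ρ δ hM h (𝟙 A) g (by simpa using hg)
  exact ⟨c, by rwa [push_id] at h1⟩

theorem IsTriangle.exact_pull (h : T.IsTriangle x y δ) {W : C} (ρ : Val T.E Z W) (hρ : pull T.E y ρ = 0) :
    ∃ f : A ⟶ W, ρ = push T.E f δ := by
  obtain ⟨M, p, q, hM⟩ := T.exists_triangle ρ
  obtain ⟨g, hg⟩ := hM.lift y hρ
  obtain ⟨c, h1, h2⟩ := T.et3_op δ ρ h hM g (𝟙 Z) (by simpa using hg.symm)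
  exact ⟨c, by rw [pull_id] at h1; exact h1.symm⟩

theorem IsTriangle.exact_push_mid (h : T.IsTriangle x y δ) {W : C} (θ : Val T.E W B) (hθ : push T.E y θ = 0) :
    ∃ τ : Val T.E W A, θ = push T.E x τ := by
  obtain ⟨M, p, q, hM⟩ := T.exists_triangle θ
  obtain ⟨N, h', d, e, δ'', -, -, -, h4, -, h6⟩ := T.et4 δ θ h hM
  rw [hθ] at h4
  obtain ⟨t, ht⟩ := IsTriangle.lift (T := T) h4 (𝟙 W) (by simp)
  refine ⟨pull T.E t δ'', ?_⟩
  rw [push_pull, h6, ← pull_comp, ht, pull_id]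

theorem IsTriangle.exact_pull_mid (h : T.IsTriangle x y δ) {W : C} (θ : Val T.E B W) (hθ : pull T.E x θ = 0) :
    ∃ τ : Val T.E Z W, θ = pull T.E y τ := by
  obtain ⟨M, p, q, hM⟩ := T.exists_triangle θ
  obtain ⟨N, d, e, h', δ'', -, -, -, h4, -, h6⟩ := T.et4_op θ δ hM h
  rw [hθ] at h4
  obtain ⟨t, ht⟩ := IsTriangle.desc (T := T) h4 (𝟙 W) (by simp)
  refine ⟨push T.E t δ'', ?_⟩
  rw [← push_pull, ← h6, ← push_comp, ht, push_id]

theorem IsTriangle.exists_desc (h : T.IsTriangle x y δ) {M : C} (m : M ⟶ Z) :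
    ∃ (K : C) (k : K ⟶ M ⊞ B), T.IsConflation k (biprod.desc m y) := by
  have h1 := T.s_sum 0 δ (T.triangle_zero_left M) h
  obtain ⟨N, d, e, h', δ'', -, -, h4, -⟩ := T.et4_op _ _ h1 (T.triangle_desc m)
  refine ⟨N, h', δ'', ?_⟩
  rw [IsTriangle, h4]
  congr 1
  ext <;> simp

end ExternalTriangulation

namespace TenAux
section
variable {C : Type u} [SmallCategory C] [Preadditive C] [HasZeroObject C] [HasBinaryBiproducts C]
variable (T : ExternalTriangulation.{u} C)

/-- Indices: extensions of varying objects by `A`. -/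
structure Ix (A : C) : Type u where
  obj : C
  cls : Val T.E obj A

instance (A : C) : Preorder (Ix T A) where
  le i j := ∃ m : i.1 ⟶ j.1, pull T.E m j.2 = i.2
  le_refl i := ⟨𝟙 _, pull_id _ _⟩
  le_trans := by
    rintro i j k ⟨m, hm⟩ ⟨m', hm'⟩
    exact ⟨m ≫ m', by rw [pull_comp, hm', hm]⟩

/-- the extension `(δ, δ')` of `M ⊞ M'` by `A` -/
noncomputable def cat {M M' A : C} (δ : Val T.E M A) (δ' : Val T.E M' A) : Val T.E (M ⊞ M') A :=
  pull T.E biprod.fst δ + pull T.E biprod.snd δ'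

variable {T} in
theorem pull_inl_cat {M M' A : C} (δ : Val T.E M A) (δ' : Val T.E M' A) :
    pull T.E biprod.inl (cat T δ δ') = δ := by
  rw [cat, map_add, ← pull_comp, ← pull_comp, biprod.inl_fst, biprod.inl_snd, pull_id,
    pull_zero T.additive, add_zero]

variable {T} in
theorem pull_inr_cat {M M' A : C} (δ : Val T.E M A) (δ' : Val T.E M' A) :
    pull T.E biprod.inr (cat T δ δ') = δ' := by
  rw [cat, map_add, ← pull_comp, ← pull_comp, biprod.inr_fst, biprod.inr_snd, pull_id,
    pull_zero T.additive, zero_add]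

instance (A : C) : IsDirectedOrder (Ix T A) where
  directed i j := ⟨⟨i.1 ⊞ j.1, cat T i.2 j.2⟩, ⟨biprod.inl, pull_inl_cat _ _⟩,
    ⟨biprod.inr, pull_inr_cat _ _⟩⟩

instance (A : C) : Nonempty (Ix T A) := ⟨⟨A, 0⟩⟩

variable {T}
variable (H : Cᵒᵖ ⥤ C ⥤ AddCommGrpCat.{u}) (X : C)

/-- the elements of `H(X, M)` that come from some `P ⟶ M` killing `δ` -/
def imSub {M A : C} (δ : Val T.E M A) : AddSubgroup (Val H X M) where
  carrier := {g | ∃ (P : C) (p : P ⟶ M) (k : Val H X P), pull T.E p δ = 0 ∧ push H p k = g}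
  zero_mem' := ⟨M, 0, 0, pull_zero T.additive _, map_zero _⟩
  neg_mem' := by
    rintro _ ⟨P, p, k, h1, rfl⟩
    exact ⟨P, p, -k, h1, map_neg _ _⟩
  add_mem' := by
    rintro _ _ ⟨P, p, k, h1, rfl⟩ ⟨P', p', k', h1', rfl⟩
    refine ⟨P ⊞ P', biprod.desc p p', push H biprod.inl k + push H biprod.inr k', ?_, ?_⟩
    · rw [biprod.desc_eq, T.additive.2, pull_comp, pull_comp, h1, h1', map_zero, map_zero, add_zero]
    · rw [map_add, ← push_comp, ← push_comp, biprod.inl_desc, biprod.inr_desc]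

/-- `H(X, M)` modulo `imSub` -/
abbrev Q {A : C} (i : Ix T A) : Type u := Val H X i.1 ⧸ imSub H X i.2

theorem imSub_le {A M N : C} {δ : Val T.E M A} {ε : Val T.E N A} (m : M ⟶ N)
    (hm : pull T.E m ε = δ) : imSub H X δ ≤ (imSub H X ε).comap (push H m) := by
  rintro _ ⟨P, p, k, h1, rfl⟩
  exact ⟨P, p ≫ m, k, by rw [pull_comp, hm, h1], by rw [push_comp]⟩

/-- transition maps -/
noncomputable def tr {A : C} (i j : Ix T A) (h : i ≤ j) : Q H X i →+ Q H X j :=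
  QuotientAddGroup.map _ _ (push H h.choose) (imSub_le H X _ h.choose_spec)

variable {H X}
theorem tr_mk (hH : IsAdditiveBifunctor H) {A : C} (i j : Ix T A) (h : i ≤ j) (m : i.1 ⟶ j.1)
    (hm : pull T.E m j.2 = i.2) (g : Val H X i.1) :
    tr H X i j h (g : Q H X i) = (push H m g : Val H X j.1) := by
  rw [tr, QuotientAddGroup.map_mk, QuotientAddGroup.eq]
  refine ⟨_, m - h.choose, g, ?_, ?_⟩
  · rw [pull_sub T.additive, hm, h.choose_spec, sub_self]
  · rw [push_sub hH]; abel

variable (T H X) in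
open Classical in
/-- the abelian group `𝔼(-, A) ⊗ H(X, -)` -/
def Ten (A : C) : Type u := AddCommGroup.DirectLimit (fun i : Ix T A => Q H X i) (tr H X)

noncomputable instance (A : C) : AddCommGroup (Ten T H X A) := by
  classical
  exact inferInstanceAs (AddCommGroup (AddCommGroup.DirectLimit _ _))

open Classical in
/-- pure tensors -/
noncomputable def mk {M A : C} (δ : Val T.E M A) : Val H X M →+ Ten T H X A :=
  (AddCommGroup.DirectLimit.of (fun i : Ix T A => Q H X i) (tr H X) ⟨M, δ⟩).comp
    (QuotientAddGroup.mk' (imSub H X δ))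

theorem mk_pull (hH : IsAdditiveBifunctor H) {M N A : C} (m : M ⟶ N) (ε : Val T.E N A)
    (g : Val H X M) : mk (pull T.E m ε) g = mk ε (push H m g) := by
  classical
  let i : Ix T A := ⟨M, pull T.E m ε⟩
  let j : Ix T A := ⟨N, ε⟩
  have hle : i ≤ j := ⟨m, rfl⟩
  have := AddCommGroup.DirectLimit.of_f (G := fun i : Ix T A => Q H X i) (f := tr H X) hle
    (g : Q H X i)
  rw [tr_mk hH _ _ hle m rfl] at this
  exact this.symm

theorem exists_mk {A : C} (t : Ten T H X A) :
    ∃ (M : C) (δ : Val T.E M A) (g : Val H X M), t = mk δ g := by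
  classical
  induction t using AddCommGroup.DirectLimit.induction_on with
  | _ i g =>
    obtain ⟨g, rfl⟩ := QuotientAddGroup.mk_surjective g
    exact ⟨i.1, i.2, g, rfl⟩

theorem mk_eq_zero (hH : IsAdditiveBifunctor H) {M A : C} {δ : Val T.E M A} {g : Val H X M}
    (h : mk δ g = 0) : ∃ (N : C) (m : M ⟶ N) (ε : Val T.E N A) (P : C) (p : P ⟶ N)
      (k : Val H X P), pull T.E m ε = δ ∧ pull T.E p ε = 0 ∧ push H p k = push H m g := by
  classical
  have : DirectedSystem (fun i : Ix T A => Q H X i) fun i j h => tr H X i j h :=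
    { map_self := by
        intro i g
        obtain ⟨g, rfl⟩ := QuotientAddGroup.mk_surjective g
        rw [tr_mk hH _ _ _ (𝟙 _) (pull_id _ _), push_id]
      map_map := by
        intro i j k hij hjk g
        obtain ⟨g, rfl⟩ := QuotientAddGroup.mk_surjective g
        obtain ⟨m, hm⟩ := id hij
        obtain ⟨m', hm'⟩ := id hjk
        rw [tr_mk hH _ _ hij m hm, tr_mk hH _ _ hjk m' hm', tr_mk hH _ _ _ (m ≫ m') ?_, push_comp]
        rw [pull_comp, hm', hm] }
  obtain ⟨⟨N, ε⟩, ⟨m, hm⟩, h0⟩ := AddCommGroup.DirectLimit.of.zero_exact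
    (G := fun i : Ix T A => Q H X i) (f := tr H X) ⟨M, δ⟩ (g : Q H X (⟨M, δ⟩ : Ix T A)) h
  rw [tr_mk hH _ _ _ m hm, QuotientAddGroup.eq_zero_iff] at h0
  obtain ⟨P, p, k, h1, h2⟩ := h0
  exact ⟨N, m, ε, P, p, k, hm, h1, h2⟩

theorem mk_add (hH : IsAdditiveBifunctor H) {M A : C} (δ δ' : Val T.E M A) (g : Val H X M) :
    mk (δ + δ') g = mk δ g + mk δ' g := by
  have h1 : δ + δ' = pull T.E (biprod.lift (𝟙 M) (𝟙 M)) (cat T δ δ') := by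
    rw [biprod.lift_eq, T.additive.2, pull_comp, pull_comp, pull_inl_cat, pull_inr_cat, pull_id,
      pull_id]
  rw [h1, mk_pull hH, biprod.lift_eq, hH.1, map_add, push_comp, push_comp, push_id,
    ← mk_pull hH, ← mk_pull hH, pull_inl_cat, pull_inr_cat]

theorem mk_zero (hH : IsAdditiveBifunctor H) {M A : C} (g : Val H X M) :
    mk (0 : Val T.E M A) g = 0 := by
  have := mk_add hH (0 : Val T.E M A) 0 g
  simpa using this

/-- universal property -/
noncomputable def lift (hH : IsAdditiveBifunctor H) {A : C} {W : Type u} [AddCommGroup W]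
    (φ : ∀ ⦃M : C⦄, Val T.E M A → Val H X M →+ W)
    (hφ : ∀ ⦃M N : C⦄ (m : M ⟶ N) (ε : Val T.E N A) (g : Val H X M),
      φ (pull T.E m ε) g = φ ε (push H m g)) : Ten T H X A →+ W := by
  classical
  refine AddCommGroup.DirectLimit.lift _ _ W (fun i => QuotientAddGroup.lift _ (φ i.2) ?_) ?_
  · rintro _ ⟨P, p, k, h1, rfl⟩
    show φ i.2 (push H p k) = 0
    rw [← hφ, h1, ← pull_zero T.additive (Y := P) i.2, hφ, push_zero hH, map_zero]
  · intro i j hij g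
    obtain ⟨g, rfl⟩ := QuotientAddGroup.mk_surjective g
    obtain ⟨m, hm⟩ := id hij
    rw [tr_mk hH _ _ hij m hm]
    simp only [QuotientAddGroup.lift_mk]
    rw [← hφ, hm]

theorem lift_mk (hH : IsAdditiveBifunctor H) {A : C} {W : Type u} [AddCommGroup W]
    (φ : ∀ ⦃M : C⦄, Val T.E M A → Val H X M →+ W)
    (hφ : ∀ ⦃M N : C⦄ (m : M ⟶ N) (ε : Val T.E N A) (g : Val H X M),
      φ (pull T.E m ε) g = φ ε (push H m g)) {M : C} (δ : Val T.E M A) (g : Val H X M) :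
    lift hH φ hφ (mk δ g) = φ δ g := by
  classical
  let i : Ix T A := ⟨M, δ⟩
  exact AddCommGroup.DirectLimit.lift_of (G := fun i : Ix T A => Q H X i) (f := tr H X) W
    (fun i => QuotientAddGroup.lift _ (φ i.2) _) _ i (g : Q H X i)

attribute [irreducible] mk lift

/-- functoriality in the second variable -/
noncomputable def pushT (hH : IsAdditiveBifunctor H) {A A' : C} (a : A ⟶ A') :
    Ten T H X A →+ Ten T H X A' :=
  lift hH (fun _ δ => mk (push T.E a δ)) (fun _ _ m ε g => by rw [push_pull, mk_pull hH])

/-- functoriality in the first variable -/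
noncomputable def pullT (hH : IsAdditiveBifunctor H) {X' : C} (f : X' ⟶ X) (A : C) :
    Ten T H X A →+ Ten T H X' A :=
  lift hH (fun _ δ => (mk δ).comp (pull H f)) (fun _ _ m ε g => by
    simp only [AddMonoidHom.comp_apply]
    rw [mk_pull hH, push_pull])

theorem pushT_mk (hH : IsAdditiveBifunctor H) {M A A' : C} (a : A ⟶ A') (δ : Val T.E M A)
    (g : Val H X M) : pushT hH a (mk δ g) = mk (push T.E a δ) g := lift_mk hH _ _ δ g

theorem pullT_mk (hH : IsAdditiveBifunctor H) {M A X' : C} (f : X' ⟶ X) (δ : Val T.E M A)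
    (g : Val H X M) : pullT hH f A (mk δ g) = mk δ (pull H f g) := lift_mk hH _ _ δ g

attribute [irreducible] pushT pullT

theorem hom_ext {A : C} {W : Type u} [AddCommGroup W] {φ ψ : Ten T H X A →+ W}
    (h : ∀ {M : C} (δ : Val T.E M A) (g : Val H X M), φ (mk δ g) = ψ (mk δ g)) : φ = ψ := by
  ext t
  obtain ⟨M, δ, g, rfl⟩ := exists_mk t
  exact h δ g

variable (T H) in
/-- the bifunctor `𝔼 ⊗ H` -/
noncomputable def tens (hH : IsAdditiveBifunctor H) : Cᵒᵖ ⥤ C ⥤ AddCommGrpCat.{u} where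
  obj X :=
    { obj := fun A => AddCommGrpCat.of (Ten T H X.unop A)
      map := fun {A A'} a => AddCommGrpCat.ofHom (pushT hH a)
      map_id := fun A => by
        rw [← AddCommGrpCat.ofHom_id]
        exact congrArg _ (hom_ext fun δ g => by rw [pushT_mk, push_id]; rfl)
      map_comp := fun a a' => by
        rw [← AddCommGrpCat.ofHom_comp]
        exact congrArg _ (hom_ext fun δ g => by
          rw [AddMonoidHom.comp_apply, pushT_mk, pushT_mk, pushT_mk, push_comp]) }
  map {X X'} f :=
    { app := fun A => AddCommGrpCat.ofHom (pullT hH f.unop A)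
      naturality := fun A A' a => by
        rw [← AddCommGrpCat.ofHom_comp, ← AddCommGrpCat.ofHom_comp]
        exact congrArg _ (hom_ext fun δ g => by
          rw [AddMonoidHom.comp_apply, AddMonoidHom.comp_apply, pushT_mk, pullT_mk, pullT_mk,
            pushT_mk]) }
  map_id X := by
    apply NatTrans.ext
    funext A
    rw [NatTrans.id_app, ← AddCommGrpCat.ofHom_id]
    exact congrArg _ (hom_ext fun δ g => by rw [unop_id, pullT_mk, pull_id]; rfl)
  map_comp f f' := by
    apply NatTrans.ext
    funext A
    rw [NatTrans.comp_app, ← AddCommGrpCat.ofHom_comp]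
    exact congrArg _ (hom_ext fun δ g => by
      rw [AddMonoidHom.comp_apply, pullT_mk, pullT_mk, pullT_mk, unop_comp, pull_comp])

/-- pure tensors, as elements of the bifunctor -/
noncomputable def tmk (hH : IsAdditiveBifunctor H) {X M A : C} (δ : Val T.E M A) :
    Val H X M →+ Val (tens T H hH) X A := mk δ

section
variable (hH : IsAdditiveBifunctor H) {X M A : C}

theorem push_tmk {A' : C} (a : A ⟶ A') (δ : Val T.E M A) (g : Val H X M) :
    push (tens T H hH) a (tmk hH δ g) = tmk hH (push T.E a δ) g := pushT_mk hH a δ g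

theorem pull_tmk {X' : C} (f : X' ⟶ X) (δ : Val T.E M A) (g : Val H X M) :
    pull (tens T H hH) f (tmk hH δ g) = tmk hH δ (pull H f g) := pullT_mk hH f δ g

theorem tmk_pull {N : C} (m : M ⟶ N) (ε : Val T.E N A) (g : Val H X M) :
    tmk hH (pull T.E m ε) g = tmk hH ε (push H m g) := mk_pull hH m ε g

theorem tmk_add (δ δ' : Val T.E M A) (g : Val H X M) :
    tmk hH (δ + δ') g = tmk hH δ g + tmk hH δ' g := mk_add hH δ δ' g

theorem tmk_zero (g : Val H X M) : tmk hH (0 : Val T.E M A) g = 0 := mk_zero hH g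

theorem exists_tmk (t : Val (tens T H hH) X A) :
    ∃ (M : C) (δ : Val T.E M A) (g : Val H X M), t = tmk hH δ g := exists_mk t

theorem tens_additive : IsAdditiveBifunctor (tens T H hH) := by
  constructor
  · intro Z A A' a b t
    obtain ⟨M, δ, g, rfl⟩ := exists_tmk hH t
    rw [push_tmk, push_tmk, push_tmk, T.additive.1, tmk_add]
  · intro Z' Z A c d t
    obtain ⟨M, δ, g, rfl⟩ := exists_tmk hH t
    rw [pull_tmk, pull_tmk, pull_tmk, hH.2, map_add]

variable (T H) in
/-- exactness of `H(X, -)` at the middle of conflations -/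
def HalfExact₂ : Prop := ∀ {A B Z : C} {x : A ⟶ B} {y : B ⟶ Z} {δ : Val T.E Z A},
  T.IsTriangle x y δ → ∀ {X : C} (t : Val H X B), push H y t = 0 → ∃ s, t = push H x s

variable (T H) in
/-- exactness of `H(-, X)` at the middle of conflations -/
def HalfExact₁ : Prop := ∀ {A B Z : C} {x : A ⟶ B} {y : B ⟶ Z} {δ : Val T.E Z A},
  T.IsTriangle x y δ → ∀ {X : C} (t : Val H B X), pull H x t = 0 → ∃ s, t = pull H y s

theorem tmk_eq_zero (h2 : HalfExact₂ T H) {B : C} {x : A ⟶ B} {y : B ⟶ M} {δ : Val T.E M A}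
    (hδ : T.IsTriangle x y δ) (g : Val H X M) (h : tmk hH δ g = 0) : ∃ k, g = push H y k := by
  obtain ⟨N, m, ε, P, p, k, hm, hp, hk⟩ := mk_eq_zero hH h
  obtain ⟨D, z, n, hε⟩ := T.exists_triangle ε
  obtain ⟨p', rfl⟩ := hε.lift p hp
  obtain ⟨K, q, η, hq⟩ := hε.exists_desc m
  obtain ⟨s, hs⟩ := h2 hq (push H biprod.inl g - push H biprod.inr (push H p' k)) (by
    rw [map_sub, ← push_comp, ← push_comp, biprod.inl_desc, biprod.inr_desc, ← push_comp, hk,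
      sub_self])
  have h3 : g = push H (q ≫ biprod.fst) s := by
    rw [push_comp, ← hs, map_sub, ← push_comp, ← push_comp, biprod.inl_fst, biprod.inr_fst,
      push_id, push_zero hH, sub_zero]
  have h4 : pull T.E (q ≫ biprod.fst) δ = 0 := by
    have h5 := hq.comp_eq_zero
    rw [biprod.desc_eq, Preadditive.comp_add] at h5
    rw [← hm, ← pull_comp, Category.assoc, eq_neg_of_add_eq_zero_left h5, pull_neg T.additive,
      pull_comp, pull_comp, hε.pull_eq_zero, map_zero, map_zero, neg_zero]
  obtain ⟨r, hr⟩ := hδ.lift _ h4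
  exact ⟨push H r s, by rw [h3, ← hr, push_comp]⟩

variable {B Z : C} {x : A ⟶ B} {y : B ⟶ Z} {δ : Val T.E Z A}

theorem tmk_push (hδ : T.IsTriangle x y δ) (k : Val H X B) : tmk hH δ (push H y k) = 0 := by
  rw [← tmk_pull, hδ.pull_eq_zero, tmk_zero]

theorem tens_exact_left (hδ : T.IsTriangle x y δ) (h2 : HalfExact₂ T H) (t : Val (tens T H hH) X A)
    (ht : push (tens T H hH) x t = 0) : ∃ g, t = tmk hH δ g := by
  obtain ⟨M, η, g, rfl⟩ := exists_tmk hH t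
  rw [push_tmk] at ht
  obtain ⟨F, u, p, hF⟩ := T.exists_triangle (push T.E x η)
  obtain ⟨k, rfl⟩ := tmk_eq_zero hH h2 hF g ht
  have h5 : push T.E x (pull T.E p η) = 0 := by rw [push_pull, hF.pull_eq_zero]
  obtain ⟨f, hf⟩ := hδ.exact_push _ h5
  exact ⟨push H f k, by rw [← tmk_pull, hf, tmk_pull]⟩

end

theorem tens_half₂ (hH : IsAdditiveBifunctor H) (h2 : HalfExact₂ T H) :
    HalfExact₂ T (tens T H hH) := by
  intro A B Z x y δ hδ X t ht
  obtain ⟨M, η, g, rfl⟩ := exists_tmk hH t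
  rw [push_tmk] at ht
  obtain ⟨F, u, p, hF⟩ := T.exists_triangle (push T.E y η)
  obtain ⟨k, rfl⟩ := tmk_eq_zero hH h2 hF g ht
  have h5 : push T.E y (pull T.E p η) = 0 := by rw [push_pull, hF.pull_eq_zero]
  obtain ⟨f, hf⟩ := hδ.exact_push_mid _ h5
  exact ⟨tmk hH f k, by rw [← tmk_pull, hf, push_tmk]⟩

end

section
variable {C : Type u} [SmallCategory C] [Preadditive C] [HasZeroObject C] [HasBinaryBiproducts C]
variable (T : ExternalTriangulation.{u} C)

/-- One step of the construction of the higher extension groups: a bifunctor `H` together with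
an isomorphism-like pairing of `H ⊗ 𝔼` with `𝔼 ⊗ H`. -/
structure Stage where
  H : Cᵒᵖ ⥤ C ⥤ AddCommGrpCat.{u}
  hH : IsAdditiveBifunctor H
  half₂ : HalfExact₂ T H
  half₁ : HalfExact₁ T H
  ν : ∀ {Z X A : C}, Val T.E Z X → (Val H X A →+ Val (tens T H hH) Z A)
  ν_add : ∀ {Z X A : C} (ε ε' : Val T.E Z X) (g : Val H X A), ν (ε + ε') g = ν ε g + ν ε' g
  ν_push : ∀ {Z X A A' : C} (a : A ⟶ A') (ε : Val T.E Z X) (g : Val H X A),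
    push (tens T H hH) a (ν ε g) = ν ε (push H a g)
  ν_pull : ∀ {Z Z' X A : C} (z : Z' ⟶ Z) (ε : Val T.E Z X) (g : Val H X A),
    pull (tens T H hH) z (ν ε g) = ν (pull T.E z ε) g
  ν_mid : ∀ {Z X X' A : C} (i : X ⟶ X') (ε : Val T.E Z X) (g : Val H X' A),
    ν ε (pull H i g) = ν (push T.E i ε) g
  ν_surj : ∀ {Z A : C} (t : Val (tens T H hH) Z A),
    ∃ (X : C) (ε : Val T.E Z X) (g : Val H X A), t = ν ε g
  ν_exact : ∀ {X Y Z : C} {x : X ⟶ Y} {y : Y ⟶ Z} {ε : Val T.E Z X}, T.IsTriangle x y ε →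
    ∀ {A : C} (g : Val H X A), ν ε g = 0 → ∃ k, g = pull H x k

variable {T}

namespace Stage
variable (S : Stage T)

/-- the next bifunctor -/
noncomputable abbrev next : Cᵒᵖ ⥤ C ⥤ AddCommGrpCat.{u} := tens T S.H S.hH

theorem next_half₁ : HalfExact₁ T S.next := by
  intro A B Z x y δ hδ X t ht
  obtain ⟨N, ε, h, rfl⟩ := S.ν_surj t
  rw [S.ν_pull] at ht
  obtain ⟨G, j, q, hG⟩ := T.exists_triangle (pull T.E x ε)
  obtain ⟨h', rfl⟩ := S.ν_exact hG h ht
  have h5 : pull T.E x (push T.E j ε) = 0 := by rw [← push_pull, hG.push_eq_zero]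
  obtain ⟨ρ, hρ⟩ := hδ.exact_pull_mid _ h5
  exact ⟨S.ν ρ h', by rw [S.ν_mid, hρ, S.ν_pull]⟩

theorem next_exact {A B Z : C} {x : A ⟶ B} {y : B ⟶ Z} {δ : Val T.E Z A}
    (hδ : T.IsTriangle x y δ) {X : C} (t : Val S.next Z X) (ht : pull S.next y t = 0) :
    ∃ f, t = S.ν δ f := by
  obtain ⟨N, ε, h, rfl⟩ := S.ν_surj t
  rw [S.ν_pull] at ht
  obtain ⟨G, j, q, hG⟩ := T.exists_triangle (pull T.E y ε)
  obtain ⟨h', rfl⟩ := S.ν_exact hG h ht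
  have h5 : pull T.E y (push T.E j ε) = 0 := by rw [← push_pull, hG.push_eq_zero]
  obtain ⟨f, hf⟩ := hδ.exact_pull _ h5
  exact ⟨pull S.H f h', by rw [S.ν_mid, hf, ← S.ν_mid]⟩

theorem ν_zero {Z X A : C} (g : Val S.H X A) : S.ν (0 : Val T.E Z X) g = 0 := by
  have := S.ν_add (0 : Val T.E Z X) 0 g
  simpa using this

/-- the next pairing -/
noncomputable def nu {Z X A : C} (ε : Val T.E Z X) :
    Val S.next X A →+ Val (tens T S.next (tens_additive S.hH)) Z A :=
  lift S.hH (W := Ten T S.next Z A) (fun _ δ => (TenAux.mk δ).comp (S.ν ε)) (by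
    intro M N m η g
    rw [AddMonoidHom.comp_apply, AddMonoidHom.comp_apply, mk_pull (tens_additive S.hH), S.ν_push])

theorem nu_tmk {Z X A M : C} (ε : Val T.E Z X) (δ : Val T.E M A) (g : Val S.H X M) :
    S.nu ε (tmk S.hH δ g) = tmk (tens_additive S.hH) δ (S.ν ε g) :=
  lift_mk S.hH _ _ δ g

theorem nu_exact {X Y Z : C} {x : X ⟶ Y} {y : Y ⟶ Z} {ε : Val T.E Z X} (hε : T.IsTriangle x y ε)
    {A : C} (t : Val S.next X A) (ht : S.nu ε t = 0) : ∃ k, t = pull S.next x k := by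
  obtain ⟨M, δ, g, rfl⟩ := exists_tmk S.hH t
  rw [nu_tmk] at ht
  obtain ⟨B, a, b, hδ⟩ := T.exists_triangle δ
  obtain ⟨q, hq⟩ := tmk_eq_zero _ (tens_half₂ S.hH S.half₂) hδ _ ht
  obtain ⟨X', ε', h, rfl⟩ := S.ν_surj q
  obtain ⟨W, w, p, hW⟩ := T.exists_triangle
    (push T.E (biprod.inr : X ⟶ X' ⊞ X) ε + push T.E (biprod.inl : X' ⟶ X' ⊞ X) ε')
  have e1 : push T.E (biprod.snd : X' ⊞ X ⟶ X)
      (push T.E (biprod.inr : X ⟶ X' ⊞ X) ε + push T.E (biprod.inl : X' ⟶ X' ⊞ X) ε') = ε := by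
    rw [map_add, ← push_comp, ← push_comp, biprod.inr_snd, biprod.inl_snd, push_id,
      push_zero T.additive, add_zero]
  have e2 : push T.E (biprod.fst : X' ⊞ X ⟶ X')
      (push T.E (biprod.inr : X ⟶ X' ⊞ X) ε + push T.E (biprod.inl : X' ⟶ X' ⊞ X) ε') = ε' := by
    rw [map_add, ← push_comp, ← push_comp, biprod.inr_fst, biprod.inl_fst, push_id,
      push_zero T.additive, zero_add]
  obtain ⟨e, he⟩ := S.ν_exact hW
    (pull S.H biprod.snd g - pull S.H biprod.fst (push S.H b h)) (by
      rw [map_sub, S.ν_mid, S.ν_mid, e1, e2, hq, S.ν_push, sub_self])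
  have hg : g = pull S.H (biprod.inr ≫ w) e := by
    rw [pull_comp, ← he, map_sub, ← pull_comp, ← pull_comp, biprod.inr_snd, biprod.inr_fst,
      pull_id, pull_zero S.hH, sub_zero]
  have hb : pull S.H (biprod.inl ≫ w) e = - push S.H b h := by
    rw [pull_comp, ← he, map_sub, ← pull_comp, ← pull_comp, biprod.inl_snd, biprod.inl_fst,
      pull_id, pull_zero S.hH, zero_sub]
  obtain ⟨N, h', d, e', δ'', h1, -, h3, h4, -⟩ := T.et4 _ _ (T.s_zero X' X) hW
  rw [e1] at h4
  obtain ⟨k, hk⟩ := S.next_half₁ h3 (tmk S.hH δ e) (by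
    rw [pull_tmk, hb, map_neg, tmk_push S.hH hδ, neg_zero])
  obtain ⟨r, hr⟩ := hε.desc d (ExternalTriangulation.IsTriangle.push_eq_zero h4)
  refine ⟨pull _ r k, ?_⟩
  rw [← pull_comp, hr, hg, ← pull_tmk, hk, ← pull_comp]
  congr 2
  rw [Category.assoc, ← h1, biprod.inr_snd_assoc]

/-- the next stage -/
noncomputable def succ : Stage T where
  H := S.next
  hH := tens_additive S.hH
  half₂ := tens_half₂ S.hH S.half₂
  half₁ := S.next_half₁
  ν := S.nu
  ν_add ε ε' t := by
    obtain ⟨M, δ, g, rfl⟩ := exists_tmk S.hH t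
    rw [nu_tmk, nu_tmk, nu_tmk, S.ν_add, map_add]
  ν_push a ε t := by
    obtain ⟨M, δ, g, rfl⟩ := exists_tmk S.hH t
    rw [nu_tmk, push_tmk, push_tmk, nu_tmk]
  ν_pull z ε t := by
    obtain ⟨M, δ, g, rfl⟩ := exists_tmk S.hH t
    rw [nu_tmk, pull_tmk, nu_tmk, S.ν_pull]
  ν_mid i ε t := by
    obtain ⟨M, δ, g, rfl⟩ := exists_tmk S.hH t
    rw [pull_tmk, nu_tmk, nu_tmk, S.ν_mid]
  ν_surj t := by
    obtain ⟨M, δ, g, rfl⟩ := exists_tmk (tens_additive S.hH) t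
    obtain ⟨X, ε, f, rfl⟩ := S.ν_surj g
    exact ⟨X, ε, tmk S.hH δ f, by rw [nu_tmk]⟩
  ν_exact hε _ t ht := S.nu_exact hε t ht

variable (T) in
/-- the first stage -/
noncomputable def zero : Stage T where
  H := T.E
  hH := T.additive
  half₂ := fun hδ _ t ht => hδ.exact_push_mid t ht
  half₁ := fun hδ _ t ht => hδ.exact_pull_mid t ht
  ν := fun ε =>
    { toFun := fun g => tmk T.additive g ε
      map_zero' := tmk_zero _ _
      map_add' := fun g g' => tmk_add _ g g' ε }
  ν_add ε ε' g := map_add (tmk T.additive g) ε ε'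
  ν_push a ε g := push_tmk T.additive a g ε
  ν_pull z ε g := pull_tmk T.additive z g ε
  ν_mid i ε g := tmk_pull T.additive i g ε
  ν_surj t := by
    obtain ⟨M, δ, g, rfl⟩ := exists_tmk T.additive t
    exact ⟨M, g, δ, rfl⟩
  ν_exact := by
    intro X Y Z x y ε hε A g hg
    obtain ⟨B, a, b, hB⟩ := T.exists_triangle g
    obtain ⟨k, rfl⟩ := tmk_eq_zero T.additive (fun hδ _ t ht => hδ.exact_push_mid t ht) hB _ hg
    obtain ⟨M, c, c', hM⟩ := T.exists_triangle k
    obtain ⟨N, h', d, e', δ'', -, -, -, h4, h5, -⟩ := T.et4 _ _ hB hM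
    obtain ⟨r, hr⟩ := hε.desc d (ExternalTriangulation.IsTriangle.push_eq_zero h4)
    exact ⟨pull T.E r δ'', by rw [← pull_comp, hr, h5]⟩

end Stage

variable (T) in
/-- all stages -/
noncomputable def stage : ℕ → Stage T
  | 0 => Stage.zero T
  | n + 1 => (stage n).succ

theorem stage_projective {M N : C} {f : M ⟶ N} (hf : T.IsProjectiveMorphism f) (n : ℕ) :
    ∀ (A : C) (t : Val (stage T n).H N A), pull (stage T n).H f t = 0 := by
  cases n with
  | zero => exact hf
  | succ n =>
    intro A t
    obtain ⟨X, ε, g, rfl⟩ := (stage T n).ν_surj t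
    exact ((stage T n).ν_pull f ε g).trans (by rw [hf, (stage T n).ν_zero]; rfl)

theorem stage_injective {M N : C} {f : M ⟶ N} (hf : T.IsInjectiveMorphism f) (n : ℕ) :
    ∀ (Z : C) (t : Val (stage T n).H Z M), push (stage T n).H f t = 0 := by
  cases n with
  | zero => exact hf
  | succ n =>
    intro A t
    obtain ⟨X, δ, g, rfl⟩ := exists_tmk (stage T n).hH t
    exact (push_tmk (stage T n).hH f δ g).trans (by rw [hf, tmk_zero]; rfl)

variable (T) in
/-- the family of higher extension bifunctors -/
noncomputable def extFam : ℕ → (Cᵒᵖ ⥤ C ⥤ AddCommGrpCat.{u})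
  | 0 => T.E
  | n + 1 => (stage T n).H

/-- first connecting transformation -/
noncomputable def c₁ : ∀ (i : ℕ) {A Z : C}, Val T.E Z A →
    ((extFam T i).obj (op A) ⟶ (extFam T (i + 1)).obj (op Z))
  | 0, _, _, _ => 0
  | n + 1, _, _, δ =>
    { app := fun _ => AddCommGrpCat.ofHom ((stage T n).ν δ)
      naturality := fun _ _ a => by
        ext t
        exact ((stage T n).ν_push a δ t).symm }

/-- second connecting transformation -/
noncomputable def c₂ : ∀ (i : ℕ) {A Z : C}, Val T.E Z A →
    ((extFam T i).flip.obj Z ⟶ (extFam T (i + 1)).flip.obj A)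
  | 0, _, _, _ => 0
  | n + 1, _, _, δ =>
    { app := fun _ => AddCommGrpCat.ofHom (tmk (stage T n).hH δ)
      naturality := fun _ _ f => by
        ext t
        exact (pull_tmk (stage T n).hH f.unop δ t).symm }

end

end TenAux

open TenAux in
/-- A small extriangulated category has higher extension groups, given by
`𝔼ⁿ⁺¹ = 𝔼 ⊗ 𝔼ⁿ` (a coend over the category). -/
theorem nonempty_higherExtensionGroups {C : Type u} [SmallCategory C] [Preadditive C]
    [HasZeroObject C] [HasBinaryBiproducts C] (T : ExternalTriangulation.{u} C) :
    Nonempty (HigherExtensionGroups T) := ⟨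
  { ext := extFam T
    additive := by
      rintro (_ | n) h
      · omega
      · exact (stage T n).hH
    ext_one := rfl
    conn₁ := c₁
    conn₂ := c₂
    exact₁_mid := by
      rintro (_ | n) h A B Z x y δ hδ Y
      · omega
      · intro t
        refine ⟨fun ht => ?_, ?_⟩
        · obtain ⟨s, hs⟩ := (stage T n).half₁ hδ t ht
          exact ⟨s, hs.symm⟩
        · rintro ⟨s, rfl⟩
          exact pull_pull_zero (stage T n).hH hδ.comp_eq_zero s
    exact₁_left := by
      rintro (_ | n) h A B Z x y δ hδ Y
      · omega
      · intro t
        refine ⟨fun ht => ?_, ?_⟩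
        · obtain ⟨s, hs⟩ := (stage T n).ν_exact hδ t ht
          exact ⟨s, hs.symm⟩
        · rintro ⟨s, rfl⟩
          exact ((stage T n).ν_mid x δ s).trans
            ((congrArg (fun z => (stage T n).ν z s) hδ.push_eq_zero).trans ((stage T n).ν_zero s))
    exact₁_right := by
      rintro (_ | n) h A B Z x y δ hδ Y
      · omega
      · intro t
        refine ⟨fun ht => ?_, ?_⟩
        · obtain ⟨s, hs⟩ := (stage T n).next_exact hδ t ht
          exact ⟨s, hs.symm⟩
        · rintro ⟨s, rfl⟩
          exact ((stage T n).ν_pull y δ s).trans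
            ((congrArg (fun z => (stage T n).ν z s) hδ.pull_eq_zero).trans ((stage T n).ν_zero s))
    exact₂_mid := by
      rintro (_ | n) h A B Z x y δ hδ Y
      · omega
      · intro t
        refine ⟨fun ht => ?_, ?_⟩
        · obtain ⟨s, hs⟩ := (stage T n).half₂ hδ t ht
          exact ⟨s, hs.symm⟩
        · rintro ⟨s, rfl⟩
          exact push_push_zero (stage T n).hH hδ.comp_eq_zero s
    exact₂_right := by
      rintro (_ | n) h A B Z x y δ hδ Y
      · omega
      · intro t
        refine ⟨fun ht => ?_, ?_⟩
        · obtain ⟨s, hs⟩ := tmk_eq_zero (stage T n).hH (stage T n).half₂ hδ t ht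
          exact ⟨s, hs.symm⟩
        · rintro ⟨s, rfl⟩
          exact tmk_push (stage T n).hH hδ s
    exact₂_left := by
      rintro (_ | n) h A B Z x y δ hδ Y
      · omega
      · intro t
        refine ⟨fun ht => ?_, ?_⟩
        · obtain ⟨s, hs⟩ := tens_exact_left (stage T n).hH hδ (stage T n).half₂ t ht
          exact ⟨s, hs.symm⟩
        · rintro ⟨s, rfl⟩
          exact (push_tmk (stage T n).hH x δ s).trans
            ((congrArg (fun z => tmk (stage T n).hH z s) hδ.push_eq_zero).trans (tmk_zero _ s))
    conn₁_natural := by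
      rintro (_ | n) h A Z A' Z' δ δ' a c hac
      · omega
      · ext Y t
        refine ((stage T n).ν_mid a δ t).trans ?_
        rw [hac]
        exact ((stage T n).ν_pull c δ' t).symm
    conn₂_natural := by
      rintro (_ | n) h A Z A' Z' δ δ' a c hac
      · omega
      · ext Y t
        refine (tmk_pull (stage T n).hH c δ' t).symm.trans ?_
        rw [← hac]
        exact (push_tmk (stage T n).hH a δ t).symm
    projective_vanish := by
      rintro (_ | n) h M N f hf
      · omega
      · exact stage_projective hf n
    injective_vanish := by
      rintro (_ | n) h M N f hf
      · omega
      · exact stage_injective hf n }⟩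

end ExtriCat

/-!
Let `X` be an `(n+2)`-cluster tilting subcategory. Completing an `X`-preenvelope of an object `M` to
an `𝔼`-triangle `M ⟶ X₀ ⟶ L` gives a *cosyzygy* `L` with `𝔼(L, X) = 0`, because every morphism from
`M` to an object of `X` factors through `X₀`. Dimension shifting shows that each further cosyzygy is
orthogonal to `X` in one more degree; after `n` further steps it is orthogonal in the degrees
`1, …, n+1` and hence lies in `X`. So a cosyzygy of *any* object has an `X`-coresolution of length
`n` (`hasCoresolution_of_preenvelope`).

Suppose `𝔼(X_n^∨, X_n^∨) = 0`. For an arbitrary `M`, take two successive cosyzygies `L` and `L'`.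
Both lie in `X_n^∨`, so the conflation `L ⟶ X₁ ⟶ L'` splits, `L` is a direct summand of `X₁`, and
therefore `L` lies in `X`. Consequently `M` has a coresolution of length `1 ≤ n`, so the conflation
`M ⟶ X₀ ⟶ L` splits as well, and `M` lies in `X`. The argument for resolutions is dual.

If every object is in `X`, then `𝔼 = 0`, which gives all the other statements. Conversely, if `X`
consists of the `𝔼`-injective objects, then the identity of each object of `X` is an `𝔼`-injective
morphism, so `𝔼ᵏ(-, X) = 0` for all `k ≥ 1`, and every object lies in `X`.
-/

namespace ExtriCat

variable {C : Type u} [Category.{v} C] [Preadditive C] [HasZeroObject C] [HasBinaryBiproducts C]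
variable {T : ExternalTriangulation.{w} C}

/-! ### Extensions in degree one -/

namespace ExternalTriangulation

theorem IsTriangle.exists_retraction {A B Z : C} {x : A ⟶ B} {y : B ⟶ Z} {δ : Val T.E Z A}
    (h : T.IsTriangle x y δ) (h0 : ∀ δ : Val T.E Z A, δ = 0) : ∃ r : B ⟶ A, x ≫ r = 𝟙 A :=
  h.desc (𝟙 A) (by rw [push_id, h0 δ])

theorem IsTriangle.exists_section {A B Z : C} {x : A ⟶ B} {y : B ⟶ Z} {δ : Val T.E Z A}
    (h : T.IsTriangle x y δ) (h0 : ∀ δ : Val T.E Z A, δ = 0) : ∃ r : Z ⟶ B, r ≫ y = 𝟙 Z :=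
  h.lift (𝟙 Z) (by rw [pull_id, h0 δ])

theorem isInjectiveMorphism_id_of_injectives {I : C} (hI : T.injectives I) :
    T.IsInjectiveMorphism (𝟙 I) := by
  intro Z δ
  obtain ⟨B, x, y, h⟩ := T.exists_triangle δ
  obtain ⟨g, hg⟩ := hI x y ⟨δ, h⟩ (𝟙 I)
  rw [← hg, push_comp, h.push_eq_zero, map_zero]

/-- The part `Hom(B, Y) → Hom(A, Y) → 𝔼(Z, Y) → 𝔼(B, Y)` of the long exact sequence: if the first
map is surjective and the last group is zero, then `𝔼(Z, Y) = 0`. -/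
theorem IsTriangle.ext_eq_zero_of_desc {A B Z Y : C} {x : A ⟶ B} {y : B ⟶ Z} {δ : Val T.E Z A}
    (h : T.IsTriangle x y δ) (hB : ∀ t : Val T.E B Y, t = 0)
    (hx : ∀ f : A ⟶ Y, ∃ f' : B ⟶ Y, x ≫ f' = f) (t : Val T.E Z Y) : t = 0 := by
  obtain ⟨f, rfl⟩ := h.exact_pull t (hB _)
  obtain ⟨f', rfl⟩ := hx f
  rw [push_comp, h.push_eq_zero, map_zero]

/-- The part `Hom(Y, B) → Hom(Y, Z) → 𝔼(Y, A) → 𝔼(Y, B)` of the long exact sequence: if the first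
map is surjective and the last group is zero, then `𝔼(Y, A) = 0`. -/
theorem IsTriangle.ext_eq_zero_of_lift {A B Z Y : C} {x : A ⟶ B} {y : B ⟶ Z} {δ : Val T.E Z A}
    (h : T.IsTriangle x y δ) (hB : ∀ t : Val T.E Y B, t = 0)
    (hy : ∀ f : Y ⟶ Z, ∃ f' : Y ⟶ B, f' ≫ y = f) (t : Val T.E Y A) : t = 0 := by
  obtain ⟨f, rfl⟩ := h.exact_push t (hB _)
  obtain ⟨f', rfl⟩ := hy f
  rw [pull_comp, h.pull_eq_zero, map_zero]

end ExternalTriangulation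

namespace HigherExtensionGroups

variable (H : HigherExtensionGroups T)

theorem ext_one_eq_zero_iff (Z A : C) :
    (∀ t : Val (H.ext 1) Z A, t = 0) ↔ ∀ t : Val T.E Z A, t = 0 := by
  rw [H.ext_one]

/-! ### Orthogonality to a subcategory -/

/-- `M ∈ ⋂_{1 ≤ k ≤ m} {}^{⊥ₖ}X`, that is, `𝔼ᵏ(M, X) = 0` for `1 ≤ k ≤ m`. -/
def leftPerp (X : ObjectProperty C) (m : ℕ) : ObjectProperty C := fun M =>
  ∀ k, 1 ≤ k → k ≤ m → ∀ N : C, X N → ∀ t : Val (H.ext k) M N, t = 0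

/-- `N ∈ ⋂_{1 ≤ k ≤ m} X^{⊥ₖ}`, that is, `𝔼ᵏ(X, N) = 0` for `1 ≤ k ≤ m`. -/
def rightPerp (X : ObjectProperty C) (m : ℕ) : ObjectProperty C := fun N =>
  ∀ k, 1 ≤ k → k ≤ m → ∀ M : C, X M → ∀ t : Val (H.ext k) M N, t = 0

variable {H}

theorem leftPerp_zero (X : ObjectProperty C) (M : C) : H.leftPerp X 0 M :=
  fun _ h1 h2 => absurd (h1.trans h2) (by decide)

theorem rightPerp_zero (X : ObjectProperty C) (M : C) : H.rightPerp X 0 M :=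
  fun _ h1 h2 => absurd (h1.trans h2) (by decide)

/-- A cosyzygy with respect to an `X`-preenvelope is left orthogonal to `X` in one more degree. -/
theorem leftPerp_succ_of_preenvelope {X : ObjectProperty C} {m : ℕ} {M X₀ L : C} {x : M ⟶ X₀}
    {y : X₀ ⟶ L} (hxy : T.IsConflation x y) (hM : H.leftPerp X m M)
    (hX₀ : H.leftPerp X (m + 1) X₀)
    (hx : ∀ Y : C, X Y → ∀ f : M ⟶ Y, ∃ f' : X₀ ⟶ Y, x ≫ f' = f) : H.leftPerp X (m + 1) L := by
  obtain ⟨δ, hδ⟩ := hxy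
  intro k h1 hk Y hY
  obtain rfl | h1' := h1.eq_or_lt
  · rw [H.ext_one_eq_zero_iff]
    exact hδ.ext_eq_zero_of_desc
      ((H.ext_one_eq_zero_iff _ _).1 (hX₀ 1 le_rfl hk Y hY)) (hx Y hY)
  · obtain ⟨j, rfl⟩ : ∃ j, k = j + 1 := ⟨k - 1, by omega⟩
    intro t
    obtain ⟨s, rfl⟩ := (H.exact₁_right j (by omega) x y δ hδ Y t).1 (hX₀ _ h1 hk Y hY _)
    rw [hM j (by omega) (by omega) Y hY s, map_zero]

/-- A syzygy with respect to an `X`-precover is right orthogonal to `X` in one more degree. -/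
theorem rightPerp_succ_of_precover {X : ObjectProperty C} {m : ℕ} {K X₀ M : C} {x : K ⟶ X₀}
    {y : X₀ ⟶ M} (hxy : T.IsConflation x y) (hM : H.rightPerp X m M)
    (hX₀ : H.rightPerp X (m + 1) X₀)
    (hy : ∀ Y : C, X Y → ∀ f : Y ⟶ M, ∃ f' : Y ⟶ X₀, f' ≫ y = f) : H.rightPerp X (m + 1) K := by
  obtain ⟨δ, hδ⟩ := hxy
  intro k h1 hk Y hY
  obtain rfl | h1' := h1.eq_or_lt
  · rw [H.ext_one_eq_zero_iff]
    exact hδ.ext_eq_zero_of_lift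
      ((H.ext_one_eq_zero_iff _ _).1 (hX₀ 1 le_rfl hk Y hY)) (hy Y hY)
  · obtain ⟨j, rfl⟩ : ∃ j, k = j + 1 := ⟨k - 1, by omega⟩
    intro t
    obtain ⟨s, rfl⟩ := (H.exact₂_left j (by omega) x y δ hδ Y t).1 (hX₀ _ h1 hk Y hY _)
    rw [hM j (by omega) (by omega) Y hY s, map_zero]

/-! ### Cluster tilting subcategories -/

namespace IsClusterTilting

variable {n : ℕ} {X : ObjectProperty C}

theorem leftPerp_of_mem (hX : H.IsClusterTilting n X) {m : ℕ} (hm : m ≤ n + 1) {M : C}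
    (hM : X M) : H.leftPerp X m M :=
  fun k h1 hk => (hX.eq_left M).1 hM k h1 (hk.trans hm)

theorem rightPerp_of_mem (hX : H.IsClusterTilting n X) {m : ℕ} (hm : m ≤ n + 1) {M : C}
    (hM : X M) : H.rightPerp X m M :=
  fun k h1 hk => (hX.eq_right M).1 hM k h1 (hk.trans hm)

theorem ext_eq_zero (hX : H.IsClusterTilting n X) {M N : C} (hM : X M) (hN : X N)
    (t : Val T.E M N) : t = 0 :=
  (H.ext_one_eq_zero_iff M N).1 ((hX.eq_left M).1 hM 1 le_rfl (by omega) N hN) t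

theorem mem_of_retract (hX : H.IsClusterTilting n X) {M M' : C} {i : M ⟶ M'} {r : M' ⟶ M}
    (hir : i ≫ r = 𝟙 M) (hM' : X M') : X M := by
  refine (hX.eq_right M).2 fun k h1 hk Y hY t => ?_
  rw [← push_id _ t, ← hir, push_comp, (hX.eq_right M').1 hM' k h1 hk Y hY (push _ i t), map_zero]

/-- Each cosyzygy gains one degree of left orthogonality, and an object that is left orthogonal in
the degrees `1, …, n+1` lies in `X`. -/
theorem hasCoresolution_of_leftPerp (hX : H.IsClusterTilting n X) :
    ∀ (m k : ℕ), k + m = n + 1 → ∀ M : C, H.leftPerp X k M → T.HasCoresolution X m M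
  | 0, k, hk, M, hM => by
    obtain rfl : k = n + 1 := hk
    exact X.le_isoClosure M ((hX.eq_left M).2 hM)
  | m + 1, k, hk, M, hM => by
    obtain ⟨X₀, L, x, y, hxy, hX₀, hx⟩ := hX.preenveloping M
    exact ⟨X₀, L, x, y, hxy, hX₀, hX.hasCoresolution_of_leftPerp m (k + 1) (by omega) L
      (leftPerp_succ_of_preenvelope hxy hM (hX.leftPerp_of_mem (by omega) hX₀) hx)⟩

/-- Each syzygy gains one degree of right orthogonality, and an object that is right orthogonal in
the degrees `1, …, n+1` lies in `X`. -/
theorem hasResolution_of_rightPerp (hX : H.IsClusterTilting n X) :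
    ∀ (m k : ℕ), k + m = n + 1 → ∀ M : C, H.rightPerp X k M → T.HasResolution X m M
  | 0, k, hk, M, hM => by
    obtain rfl : k = n + 1 := hk
    exact X.le_isoClosure M ((hX.eq_right M).2 hM)
  | m + 1, k, hk, M, hM => by
    obtain ⟨K, X₀, x, y, hxy, hX₀, hy⟩ := hX.precovering M
    exact ⟨K, X₀, x, y, hxy, hX₀, hX.hasResolution_of_rightPerp m (k + 1) (by omega) K
      (rightPerp_succ_of_precover hxy hM (hX.rightPerp_of_mem (by omega) hX₀) hy)⟩

theorem hasCoresolution_of_preenvelope (hX : H.IsClusterTilting n X) {M X₀ L : C} {x : M ⟶ X₀}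
    {y : X₀ ⟶ L} (hxy : T.IsConflation x y) (hX₀ : X X₀)
    (hx : ∀ Y : C, X Y → ∀ f : M ⟶ Y, ∃ f' : X₀ ⟶ Y, x ≫ f' = f) : T.HasCoresolution X n L :=
  hX.hasCoresolution_of_leftPerp n 1 (by omega) L
    (leftPerp_succ_of_preenvelope hxy (leftPerp_zero X M)
      (hX.leftPerp_of_mem (by omega) hX₀) hx)

theorem hasResolution_of_precover (hX : H.IsClusterTilting n X) {K X₀ M : C} {x : K ⟶ X₀}
    {y : X₀ ⟶ M} (hxy : T.IsConflation x y) (hX₀ : X X₀)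
    (hy : ∀ Y : C, X Y → ∀ f : Y ⟶ M, ∃ f' : Y ⟶ X₀, f' ≫ y = f) : T.HasResolution X n K :=
  hX.hasResolution_of_rightPerp n 1 (by omega) K
    (rightPerp_succ_of_precover hxy (rightPerp_zero X M)
      (hX.rightPerp_of_mem (by omega) hX₀) hy)

theorem mem_of_vanishesOn_coresClass (hX : H.IsClusterTilting n X) (hn : 1 ≤ n)
    (h : VanishesOn T.E (T.coresClass X n) (T.coresClass X n)) (M : C) : X M := by
  have split : ∀ {A X₀ L : C} {x : A ⟶ X₀} {y : X₀ ⟶ L}, T.IsConflation x y → X X₀ →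
      T.coresClass X n A → T.coresClass X n L → X A := by
    rintro A X₀ L x y ⟨δ, hδ⟩ hX₀ hA hL
    obtain ⟨r, hr⟩ := hδ.exists_retraction (h L A hL hA)
    exact hX.mem_of_retract hr hX₀
  obtain ⟨X₀, L, x, y, hxy, hX₀, hx⟩ := hX.preenveloping M
  obtain ⟨X₁, L', x', y', hxy', hX₁, hx'⟩ := hX.preenveloping L
  have hL : T.coresClass X n L := ⟨n, le_rfl, hX.hasCoresolution_of_preenvelope hxy hX₀ hx⟩
  have hL' : T.coresClass X n L' := ⟨n, le_rfl, hX.hasCoresolution_of_preenvelope hxy' hX₁ hx'⟩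
  have hXL : X L := split hxy' hX₁ hL hL'
  exact split hxy hX₀ ⟨1, hn, X₀, L, x, y, hxy, hX₀, X.le_isoClosure L hXL⟩ hL

theorem mem_of_vanishesOn_resClass (hX : H.IsClusterTilting n X) (hn : 1 ≤ n)
    (h : VanishesOn T.E (T.resClass X n) (T.resClass X n)) (M : C) : X M := by
  have split : ∀ {K X₀ A : C} {x : K ⟶ X₀} {y : X₀ ⟶ A}, T.IsConflation x y → X X₀ →
      T.resClass X n A → T.resClass X n K → X A := by
    rintro K X₀ A x y ⟨δ, hδ⟩ hX₀ hA hK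
    obtain ⟨r, hr⟩ := hδ.exists_section (h A K hA hK)
    exact hX.mem_of_retract hr hX₀
  obtain ⟨K, X₀, x, y, hxy, hX₀, hy⟩ := hX.precovering M
  obtain ⟨K', X₁, x', y', hxy', hX₁, hy'⟩ := hX.precovering K
  have hK : T.resClass X n K := ⟨n, le_rfl, hX.hasResolution_of_precover hxy hX₀ hy⟩
  have hK' : T.resClass X n K' := ⟨n, le_rfl, hX.hasResolution_of_precover hxy' hX₁ hy'⟩
  have hXK : X K := split hxy' hX₁ hK hK'
  exact split hxy hX₀ ⟨1, hn, K, X₀, x, y, hxy, hX₀, X.le_isoClosure K hXK⟩ hK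

theorem mem_of_le_injectives (hX : H.IsClusterTilting n X) (h : X ≤ T.injectives) (M : C) :
    X M := by
  refine (hX.eq_left M).2 fun k h1 _ Y hY t => ?_
  rw [← push_id _ t]
  exact H.injective_vanish k h1 _
    (ExternalTriangulation.isInjectiveMorphism_id_of_injectives (h Y hY)) M t

theorem eq_projectives_and_eq_injectives (hX : H.IsClusterTilting n X) (h : ∀ M, X M) :
    X = T.projectives ∧ X = T.injectives := by
  constructor
  · refine le_antisymm (fun P _ A B Z x y hxy f => ?_) fun P _ => h P
    obtain ⟨δ, hδ⟩ := hxy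
    exact hδ.lift f (hX.ext_eq_zero (h _) (h _) _)
  · refine le_antisymm (fun I _ A B Z x y hxy f => ?_) fun I _ => h I
    obtain ⟨δ, hδ⟩ := hxy
    exact hδ.desc f (hX.ext_eq_zero (h _) (h _) _)

end IsClusterTilting

end HigherExtensionGroups

end ExtriCat

theorem mainTheorem11 {C : Type u} [SmallCategory C] [Preadditive C] [HasZeroObject C] [HasBinaryBiproducts C]
    (T : ExtriCat.ExternalTriangulation.{u} C) (H : ExtriCat.HigherExtensionGroups T)
    (n : ℕ) (hn : 1 ≤ n) (X : ObjectProperty C) (hX : H.IsClusterTilting n X) :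
    List.TFAE
      [ExtriCat.VanishesOn T.E (T.coresClass X n) (T.coresClass X n),
       ∀ M : C, X M,
       X = T.projectives ∧ X = T.injectives,
       ExtriCat.VanishesOn T.E (T.resClass X n) (T.resClass X n)] := by
  tfae_have 1 → 2 := hX.mem_of_vanishesOn_coresClass hn
  tfae_have 2 → 1 := fun h M N _ _ => hX.ext_eq_zero (h M) (h N)
  tfae_have 2 → 3 := hX.eq_projectives_and_eq_injectives
  tfae_have 3 → 2 := fun h => hX.mem_of_le_injectives h.2.le
  tfae_have 4 → 2 := hX.mem_of_vanishesOn_resClass hn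
  tfae_have 2 → 4 := fun h M N _ _ => hX.ext_eq_zero (h M) (h N)
  tfae_finish
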